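/- All graphs are finite and simple. A \emph{$k$-stack layout} (a book embedding with $k$ pages) of a graph $G$ consists of a linear ordering $v_1,\dots,v_n$ of $V(G)$ and a partition $E_1,\dots,E_k$ of $E(G)$ (parts may be empty) such that no two edges in the same $E_i$ cross, where edges $v_av_b$ and $v_cv_d$ cross if $a<c<b<d$. A graph is a \emph{$k$-stack graph} if it has a $k$-stack layout. A graph $G$ is \emph{$(k,d)$-colourable} if its vertices can be assigned colours from a set of $k$ colours so that every vertex $v$ has at most $d$ neighbours with the same colour as $v$. It is \emph{$(k,d)$-choosable} if for every assignment of a set $L(v)$ of exactly $k$ colours to each vertex $v$, one can choose for each vertex $v$ a colour in $L(v)$ so that every vertex has at most $d$ neighbours with its own colour. The \emph{defective chromatic number} (respectively, \emph{defective choice number}) of a class $\mathcal{C}$ of graphs is the minimum integer $k\ge 0$ for which there exists an integer $d\ge 0$ such that every graph in $\mathcal{C}$ is $(k,d)$-colourable (respectively, $(k,d)$-choosable). \textbf{Theorem.} For every integer $k\ge 0$, the class of $k$-stack graphs has defective chromatic number and defective choice number equal to $k+1$. Moreover, there is a function $d:\mathbb{N}\to\mathbb{N}$ with $d(k)\le 2^{O(k\log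 k)}$, that is, $d(k)\le 2^{Ck\log k}$ for some constant $C$ and all $k\ge 2$, such that for every integer $k\ge 0$ every $k$-stack graph is $(k+1,d(k))$-choosable. -/

import Mathlib

universe u

/-- A class of simple graphs: a property of simple graphs on arbitrary vertex types. -/
abbrev GraphClass : Type (u + 1) := ∀ V : Type u, SimpleGraph V → Prop

/-- The vertex colouring `c` of `G` has defect `d`: every vertex `x` has at most `d` neighbours
with the same colour as `x`. (No adjacent vertices are required to get distinct colours.) -/
def HasDefect {V : Type u} {α : Type*} (G : SimpleGraph V) (c : V → α) (d : ℕ) : Prop :=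
  ∀ x : V, {y : V | G.Adj x y ∧ c y = c x}.encard ≤ d

/-- `G` is `(k, d)`-colourable. -/
def DefectiveColorable {V : Type u} (G : SimpleGraph V) (k d : ℕ) : Prop :=
  ∃ c : V → Fin k, HasDefect G c d

/-- `G` is `(k, d)`-choosable: for every assignment `L` of lists of exactly `k` colours to the
vertices there is a colouring with defect `d` that takes the colour of each vertex from its list. -/
def DefectiveChoosable {V : Type u} (G : SimpleGraph V) (k d : ℕ) : Prop :=
  ∀ (α : Type) (L : V → Finset α), (∀ x, (L x).card = k) →
    ∃ c : V → α, (∀ x, c x ∈ L x) ∧ HasDefect G c d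

/-- `k` is the defective chromatic number of the class `𝒞`: the minimum `k` for which there is
a `d` such that every graph in `𝒞` is `(k, d)`-colourable. -/
def IsDefectiveChromaticNumber (𝒞 : GraphClass.{u}) (k : ℕ) : Prop :=
  IsLeast {j : ℕ | ∃ d : ℕ, ∀ (V : Type u) (G : SimpleGraph V), 𝒞 V G →
    DefectiveColorable G j d} k

/-- `k` is the defective choice number of the class `𝒞`: the minimum `k` for which there is
a `d` such that every graph in `𝒞` is `(k, d)`-choosable. -/
def IsDefectiveChoiceNumber (𝒞 : GraphClass.{u}) (k : ℕ) : Prop :=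
  IsLeast {j : ℕ | ∃ d : ℕ, ∀ (V : Type u) (G : SimpleGraph V), 𝒞 V G →
    DefectiveChoosable G j d} k

/-- A `k`-stack layout (a book embedding with `k` pages) of a finite graph `G`: a linear ordering
`v 0, v 1, …, v (n - 1)` of its vertices and a partition of its edges into `k` (possibly empty)
parts, given by `page`, such that no two edges in the same part cross. The edges `v a v b` and
`v c v d` cross if `a < c < b < d`. -/
structure StackLayout {V : Type u} (G : SimpleGraph V) (k : ℕ) where
  n : ℕ
  v : Fin n ≃ V
  page : G.edgeSet → Fin k
  noncrossing : ∀ (a b c d : Fin n) (hab : G.Adj (v a) (v b)) (hcd : G.Adj (v c) (v d)),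
    a < c → c < b → b < d →
      page ⟨s(v a, v b), G.mem_edgeSet.mpr hab⟩ ≠ page ⟨s(v c, v d), G.mem_edgeSet.mpr hcd⟩

/-- The class of `k`-stack graphs (finite simple graphs with a `k`-stack layout). -/
def stackGraphs (k : ℕ) : GraphClass.{u} :=
  fun _ G => Nonempty (StackLayout G k)

/-!
For the upper bound, a graph each of whose nonempty subgraphs has a nonisolated vertex of degree at
most `k` or a `d`-light edge is `(k + 1, d)`-choosable: delete that vertex or that edge, colour the
rest, and either give the vertex a colour unused on its neighbours or keep the colouring. For a
`k`-stack graph such a vertex or edge exists with `d = 4 * k * (4 * k + 1)`. Indeed, suppose that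
all nonisolated vertices have degree more than `k` and that the set `A` of those of degree at most
`d` is independent, and let `B` be the set of the others. Every vertex of `A` has two neighbours in
`B` on the same page, and absence of crossings gives `|A| ≤ 4 * k * |B|`. Since a `k`-stack graph on
`n` vertices has at most `2 * k * n` edges, the degree sum over `B` is at most
`4 * k * (|A| + |B|) ≤ d * |B|`, which is too small.

For the lower bound, add to `d + 1` disjoint copies of a `k`-stack graph that is not
`(k, d)`-colourable a vertex adjacent to everything. One new page suffices for its edges, and in a
`(k + 1, d)`-colouring its colour would be missing from one of the copies.
-/

section LightEdges

variable {V : Type u} {α : Type*} {G : SimpleGraph V} {c : V → α} {k d : ℕ}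

theorem hasDefect_update_of_deleteIncidenceSet [DecidableEq V] {x : V} {t : α}
    (hc : HasDefect (G.deleteIncidenceSet x) c d) (ht : t ∉ c '' G.neighborSet x) :
    HasDefect G (Function.update c x t) d := by
  have ht_ne : ∀ y, G.Adj x y → c y ≠ t := fun y hxy hy => ht ⟨y, hxy, hy⟩
  intro y
  rcases eq_or_ne y x with rfl | hyx
  · have hempty : {z | G.Adj y z ∧ Function.update c y t z = Function.update c y t y} = ∅ := by
      refine Set.eq_empty_of_forall_notMem fun z ⟨hyz, hz⟩ => ht_ne z hyz ?_
      rwa [Function.update_self, Function.update_of_ne hyz.ne'] at hz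
    rw [hempty, Set.encard_empty]
    exact zero_le
  · refine (Set.encard_le_encard ?_).trans (hc y)
    rintro z ⟨hyz, hz⟩
    rw [Function.update_of_ne hyx] at hz
    rcases eq_or_ne z x with rfl | hzx
    · rw [Function.update_self] at hz
      exact absurd hz.symm (ht_ne y hyz.symm)
    · rw [Function.update_of_ne hzx] at hz
      exact ⟨SimpleGraph.deleteIncidenceSet_adj.mpr ⟨hyz, hyx, hzx⟩, hz⟩

theorem HasDefect.of_deleteEdges_singleton {x y : V}
    (hc : HasDefect (G.deleteEdges {s(x, y)}) c d) (hx : (G.neighborSet x).encard ≤ d)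
    (hy : (G.neighborSet y).encard ≤ d) : HasDefect G c d := by
  intro z
  have le_neighborSet : {w | G.Adj z w ∧ c w = c z}.encard ≤ (G.neighborSet z).encard :=
    Set.encard_le_encard fun w hw => hw.1
  rcases eq_or_ne z x with rfl | hzx
  · exact le_neighborSet.trans hx
  rcases eq_or_ne z y with rfl | hzy
  · exact le_neighborSet.trans hy
  refine (Set.encard_le_encard ?_).trans (hc z)
  rintro w ⟨hzw, hw⟩
  exact ⟨by simp [SimpleGraph.deleteEdges_adj, hzw, hzx, hzy], hw⟩

/-- The graph has a nonisolated vertex of degree at most `k`, or a `d`-light edge: an edge both of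
whose ends have degree at most `d`. Isolated vertices do not count, so that subgraphs can be taken
on the same vertex set. -/
def HasLowVertexOrLightEdge (G : SimpleGraph V) (k d : ℕ) : Prop :=
  (∃ x, (G.neighborSet x).Nonempty ∧ (G.neighborSet x).encard ≤ k) ∨
    ∃ x y, G.Adj x y ∧ (G.neighborSet x).encard ≤ d ∧ (G.neighborSet y).encard ≤ d

theorem defectiveChoosable_of_forall_le_hasLowVertexOrLightEdge [Finite V]
    (hG : ∀ H ≤ G, H ≠ ⊥ → HasLowVertexOrLightEdge H k d) : DefectiveChoosable G (k + 1) d := by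
  classical
  intro α L hL
  induction G using WellFoundedLT.induction with
  | ind G ih =>
  rcases eq_or_ne G ⊥ with rfl | hne
  · choose c hc using fun x => Finset.card_pos.mp (by rw [hL x]; omega : 0 < (L x).card)
    exact ⟨c, hc, fun x => by simp⟩
  have exists_of_lt : ∀ H < G, ∃ c : V → α, (∀ x, c x ∈ L x) ∧ HasDefect H c d :=
    fun H hH => ih H hH fun K hK => hG K (hK.trans hH.le)
  rcases hG G le_rfl hne with ⟨x, ⟨y, hxy⟩, hx⟩ | ⟨x, y, hxy, hx, hy⟩
  · have hlt : G.deleteIncidenceSet x < G :=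
      lt_of_le_not_ge (G.deleteIncidenceSet_le x) fun hle =>
        (SimpleGraph.deleteIncidenceSet_adj.mp (hle hxy)).2.1 rfl
    obtain ⟨c, hcL, hc⟩ := exists_of_lt _ hlt
    obtain ⟨t, htL, ht⟩ : ∃ t ∈ (L x : Set α), t ∉ c '' G.neighborSet x := by
      refine Set.not_subset.mp fun hsub => ?_
      have hle := (Set.encard_le_encard hsub).trans ((Set.encard_image_le _ _).trans hx)
      rw [Set.encard_coe_eq_coe_finsetCard, hL x, Nat.cast_le] at hle
      exact k.not_succ_le_self hle
    refine ⟨Function.update c x t, fun y => ?_, hasDefect_update_of_deleteIncidenceSet hc ht⟩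
    rcases eq_or_ne y x with rfl | hyx
    · simpa using htL
    · simpa [hyx] using hcL y
  · have hlt : G.deleteEdges {s(x, y)} < G := lt_of_le_not_ge (G.deleteEdges_le _) fun hle => by
      simpa [SimpleGraph.deleteEdges_adj] using hle hxy
    obtain ⟨c, hcL, hc⟩ := exists_of_lt _ hlt
    exact ⟨c, hcL, hc.of_deleteEdges_singleton hx hy⟩

end LightEdges

section Counting

open Finset

variable {α β : Type*} [LinearOrder α]

theorem injOn_of_lt_imp_ne {s : Set α} {f : α → β}
    (h : ∀ x ∈ s, ∀ y ∈ s, x < y → f x ≠ f y) : Set.InjOn f s := by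
  intro x hx y hy hxy
  by_contra hne
  rcases lt_or_gt_of_ne hne with hlt | hlt
  · exact h x hx y hy hlt hxy
  · exact h y hy x hx hlt hxy.symm

theorem card_le_two_mul_card_of_lt_imp_ne {s : Finset α} {t : Finset β} {f g : α → β}
    (hf : ∀ x ∈ s, f x ∈ t) (hg : ∀ x ∈ s, g x ∈ t)
    (hfg : ∀ x ∈ s, ∀ y ∈ s, ∀ z ∈ s, x < y → y < z → f x = f y → g y ≠ g z) :
    #s ≤ 2 * #t := by
  classical
  let IsFirst (y : α) : Prop := ∀ x ∈ s, x < y → f x ≠ f y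
  have hfirst : #{y ∈ s | IsFirst y} ≤ #t := by
    refine card_le_card_of_injOn f (fun x hx => hf x (mem_filter.mp hx).1)
      (injOn_of_lt_imp_ne fun x hx y hy => ?_)
    exact (mem_filter.mp hy).2 x (mem_filter.mp hx).1
  have hnot_first : #{y ∈ s | ¬ IsFirst y} ≤ #t := by
    refine card_le_card_of_injOn g (fun x hx => hg x (mem_filter.mp hx).1)
      (injOn_of_lt_imp_ne fun y hy z hz hyz => ?_)
    obtain ⟨hys, hy⟩ := mem_filter.mp hy
    obtain ⟨x, hx, hxy, hxy_eq⟩ : ∃ x ∈ s, x < y ∧ f x = f y := by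
      simpa [IsFirst] using hy
    exact hfg x hx y hys z (mem_filter.mp hz).1 hxy hyz hxy_eq
  calc #s = #{y ∈ s | IsFirst y} + #{y ∈ s | ¬ IsFirst y} :=
        (card_filter_add_card_filter_not _).symm
    _ ≤ 2 * #t := by omega

end Counting

/-- No two edges of the graph cross with respect to the order of its vertices: the vertices and
edges of the graph can be placed on a single page. -/
def IsNoncrossing {V : Type*} [LinearOrder V] (H : SimpleGraph V) : Prop :=
  ∀ ⦃a b c d : V⦄, a < b → b < c → c < d → H.Adj a c → ¬ H.Adj b d

namespace IsNoncrossing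

open Finset

variable {V : Type*} [LinearOrder V] {H : SimpleGraph V}

theorem mono {H' : SimpleGraph V} (h : IsNoncrossing H) (hle : H' ≤ H) : IsNoncrossing H' :=
  fun _ _ _ _ hab hbc hcd hac hbd => h hab hbc hcd (hle hac) (hle hbd)

theorem card_edgeFinset_le [Fintype V] [DecidableRel H.Adj] (h : IsNoncrossing H) {S : Finset V}
    (hS : H.support ⊆ S) : #H.edgeFinset ≤ 2 * #S := by
  classical
  let left (e : V ×ₗ V) : V := (ofLex e).1
  let right (e : V ×ₗ V) : V := (ofLex e).2
  let E : Finset (V ×ₗ V) := {e | H.Adj (left e) (right e) ∧ left e < right e}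
  have mem_E {e} : e ∈ E ↔ H.Adj (left e) (right e) ∧ left e < right e := by simp [E]
  have hsub : H.edgeFinset ⊆ E.image fun e => s(left e, right e) := by
    intro e he
    induction e with
    | _ a b =>
    rw [SimpleGraph.mem_edgeFinset, SimpleGraph.mem_edgeSet] at he
    rw [mem_image]
    rcases lt_or_gt_of_ne he.ne with hab | hab
    · exact ⟨toLex (a, b), mem_E.mpr ⟨he, hab⟩, rfl⟩
    · exact ⟨toLex (b, a), mem_E.mpr ⟨he.symm, hab⟩, Sym2.eq_swap⟩
  refine (card_le_card hsub).trans (card_image_le.trans ?_)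
  refine card_le_two_mul_card_of_lt_imp_ne (f := right) (g := left)
    (fun e he => hS ⟨_, (mem_E.mp he).1.symm⟩) (fun e he => hS ⟨_, (mem_E.mp he).1⟩) ?_
  -- Of two edges with the same right end the longer one comes first in the lexicographic order;
  -- of two edges with the same left end, the shorter one.
  intro e₁ h₁ e₂ h₂ e₃ h₃ h₁₂ h₂₃ hright hleft
  rw [mem_E] at h₁ h₂ h₃
  have hlt_left : left e₁ < left e₂ :=
    (Prod.Lex.lt_iff.mp h₁₂).resolve_right fun h => h.2.ne hright
  have hlt_right : right e₂ < right e₃ :=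
    ((Prod.Lex.lt_iff.mp h₂₃).resolve_left fun h => h.ne hleft).2
  exact h hlt_left h₂.2 hlt_right (hright ▸ h₁.1) (hleft ▸ h₃.1)

section TwoNeighbors

variable {A B : Finset V} {u v : V → V}

theorem card_le_two_mul_card_of_between (h : IsNoncrossing H) (hAB : Disjoint A B)
    (hu : ∀ a ∈ A, u a ∈ B ∧ H.Adj a (u a)) (hv : ∀ a ∈ A, v a ∈ B ∧ H.Adj a (v a))
    (hbetween : ∀ a ∈ A, u a < a ∧ a < v a) : #A ≤ 2 * #B := by
  refine card_le_two_mul_card_of_lt_imp_ne (f := v) (g := u) (fun a ha => (hv a ha).1)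
    (fun a ha => (hu a ha).1) ?_
  -- Write `v` for the common neighbour `v x = v y` and `u` for `u y = u z`. The edges at `y` force
  -- `x < u` and `v < z`, and then the edges from `x` to `v` and from `u` to `z` cross.
  intro x hx y hy z hz hxy hyz hvxy huyz
  have hx_le : x ≤ u y := le_of_not_gt fun hlt =>
    h hlt hxy (hvxy ▸ (hbetween y hy).2 : y < v x) (hu y hy).2.symm (hv x hx).2
  have hxu : x < u y := lt_of_le_of_ne hx_le (disjoint_iff_ne.mp hAB x hx _ (hu y hy).1)
  have hle_z : v y ≤ z := le_of_not_gt fun hlt =>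
    h (huyz ▸ (hbetween y hy).1 : u z < y) hyz hlt (hu z hz).2.symm (hv y hy).2
  have hvz : v y < z := lt_of_le_of_ne hle_z (disjoint_iff_ne.mp hAB z hz _ (hv y hy).1).symm
  refine h hxu ((hbetween y hy).1.trans (hbetween y hy).2) hvz (hvxy ▸ (hv x hx).2) ?_
  exact huyz ▸ (hu z hz).2.symm

theorem card_le_four_mul_card (h : IsNoncrossing H) (hAB : Disjoint A B)
    (hA : ∀ a ∈ A, ∃ u ∈ B, ∃ v ∈ B, u < v ∧ H.Adj a u ∧ H.Adj a v) : #A ≤ 4 * #B := by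
  classical
  choose! u hu v hv huv hau hav using hA
  have hbefore : #{a ∈ A | a < u a} ≤ #B := by
    refine card_le_card_of_injOn u (fun a ha => hu a (mem_filter.mp ha).1)
      (injOn_of_lt_imp_ne fun a ha b hb hab heq => ?_)
    obtain ⟨ha, -⟩ := mem_filter.mp ha
    obtain ⟨hb, hbu⟩ := mem_filter.mp hb
    exact h hab (heq ▸ hbu) (heq ▸ huv b hb) (hau a ha) (hav b hb)
  have hafter : #{a ∈ A | v a < a} ≤ #B := by
    refine card_le_card_of_injOn v (fun a ha => hv a (mem_filter.mp ha).1)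
      (injOn_of_lt_imp_ne fun a ha b hb hab heq => ?_)
    obtain ⟨ha, hva⟩ := mem_filter.mp ha
    obtain ⟨hb, -⟩ := mem_filter.mp hb
    exact h (heq ▸ huv a ha) (heq ▸ hva) hab (hau a ha).symm (hav b hb).symm
  have hbetween : #{a ∈ A | u a < a ∧ a < v a} ≤ 2 * #B := by
    refine h.card_le_two_mul_card_of_between (u := u) (v := v)
      (disjoint_of_subset_left (filter_subset _ _) hAB) ?_ ?_ fun a ha => (mem_filter.mp ha).2
    · exact fun a ha => ⟨hu a (mem_filter.mp ha).1, hau a (mem_filter.mp ha).1⟩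
    · exact fun a ha => ⟨hv a (mem_filter.mp ha).1, hav a (mem_filter.mp ha).1⟩
  have hcover : A ⊆ ({a ∈ A | a < u a} ∪ {a ∈ A | v a < a}) ∪ {a ∈ A | u a < a ∧ a < v a} := by
    intro a ha
    have := (hau a ha).ne
    have := (hav a ha).ne
    simp only [mem_union, mem_filter, ha, true_and]
    grind
  have := (card_le_card hcover).trans (card_union_le _ _)
  have := card_union_le {a ∈ A | a < u a} {a ∈ A | v a < a}
  omega

end TwoNeighbors

theorem starGraph (r : V) : IsNoncrossing (SimpleGraph.starGraph r) := by
  intro a b c d hab hbc hcd hac hbd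
  rw [SimpleGraph.starGraph_adj] at hac hbd
  grind

theorem map (h : IsNoncrossing H) {W : Type*} [LinearOrder W] (f : V ↪o W) :
    IsNoncrossing (H.map f.toEmbedding) := by
  rintro _ _ _ _ hab hbc hcd hac hbd
  rw [SimpleGraph.map_adj] at hac hbd
  obtain ⟨a, c, hac, rfl, rfl⟩ := hac
  obtain ⟨b, d, hbd, rfl, rfl⟩ := hbd
  exact h (f.lt_iff_lt.mp hab) (f.lt_iff_lt.mp hbc) (f.lt_iff_lt.mp hcd) hac hbd

end IsNoncrossing

/-- The order of the vertices of the graph is the order of a `k`-stack layout: the graph is the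
union of `k` noncrossing graphs, its pages. The pages are not required to be disjoint, an edge on
several of them can be assigned to any one. -/
def IsStackOrder {V : Type*} [LinearOrder V] (G : SimpleGraph V) (k : ℕ) : Prop :=
  ∃ H : Fin k → SimpleGraph V, (∀ p, IsNoncrossing (H p)) ∧ G = ⨆ p, H p

namespace IsStackOrder

open Finset

variable {V : Type u} [LinearOrder V] {G : SimpleGraph V} {k : ℕ}

theorem mono {G' : SimpleGraph V} (h : IsStackOrder G k) (hle : G' ≤ G) : IsStackOrder G' k := by
  obtain ⟨H, hH, rfl⟩ := h
  refine ⟨fun p => G' ⊓ H p, fun p => (hH p).mono inf_le_right, ?_⟩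
  rw [← inf_iSup_eq, inf_eq_left.mpr hle]

theorem card_edgeFinset_le [Fintype V] [DecidableRel G.Adj] (h : IsStackOrder G k)
    {S : Finset V} (hS : G.support ⊆ S) : #G.edgeFinset ≤ 2 * k * #S := by
  classical
  obtain ⟨H, hH, hG⟩ := h
  have hcover : G.edgeFinset ⊆ univ.biUnion fun p => (H p).edgeFinset := by
    intro e he
    induction e with
    | _ a b => simpa [hG] using he
  have hpage : ∀ p ∈ univ, #(H p).edgeFinset ≤ 2 * #S := fun p _ =>
    (hH p).card_edgeFinset_le ((SimpleGraph.support_mono (hG ▸ le_iSup H p)).trans hS)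
  calc #G.edgeFinset ≤ #(univ : Finset (Fin k)) * (2 * #S) :=
        (card_le_card hcover).trans (card_biUnion_le_card_mul _ _ _ hpage)
    _ = 2 * k * #S := by rw [card_univ, Fintype.card_fin]; ring

theorem card_le_of_lt_degree [Fintype V] [DecidableRel G.Adj] (h : IsStackOrder G k)
    {A B : Finset V} (hAB : Disjoint A B) (hA : ∀ a ∈ A, ∀ b, G.Adj a b → b ∈ B)
    (hdeg : ∀ a ∈ A, k < G.degree a) : #A ≤ 4 * k * #B := by
  classical
  obtain ⟨H, hH, hG⟩ := h
  let fork (p : Fin k) (a : V) : Prop := ∃ u ∈ B, ∃ v ∈ B, u < v ∧ (H p).Adj a u ∧ (H p).Adj a v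
  have hcover : A ⊆ univ.biUnion fun p => {a ∈ A | fork p a} := by
    intro a ha
    have hpage : ∀ b : G.neighborSet a, ∃ p, (H p).Adj a b := fun b =>
      SimpleGraph.iSup_adj.mp (hG ▸ b.2)
    choose page hpage using hpage
    obtain ⟨u, v, huv, hp⟩ := Fintype.exists_ne_map_eq_of_card_lt page (by
      rw [Fintype.card_fin, G.card_neighborSet_eq_degree]
      exact hdeg a ha)
    wlog hlt : u < v generalizing u v
    · exact this v u huv.symm hp.symm (lt_of_le_of_ne (not_lt.mp hlt) huv.symm)
    simp only [mem_biUnion, mem_univ, true_and, mem_filter]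
    exact ⟨page u, ha, u, hA a ha u u.2, v, hA a ha v v.2, hlt, hpage u, hp ▸ hpage v⟩
  have hfork : ∀ p ∈ univ, #{a ∈ A | fork p a} ≤ 4 * #B := fun p _ =>
    (hH p).card_le_four_mul_card (disjoint_of_subset_left (filter_subset _ _) hAB)
      fun a ha => (mem_filter.mp ha).2
  calc #A ≤ #(univ : Finset (Fin k)) * (4 * #B) :=
        (card_le_card hcover).trans (card_biUnion_le_card_mul _ _ _ hfork)
    _ = 4 * k * #B := by rw [card_univ, Fintype.card_fin]; ring

theorem sum_degree_le [Fintype V] [DecidableRel G.Adj] (h : IsStackOrder G k) {S : Finset V}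
    (hS : G.support ⊆ S) (B : Finset V) : ∑ x ∈ B, G.degree x ≤ 4 * k * #S :=
  calc ∑ x ∈ B, G.degree x ≤ ∑ x, G.degree x := sum_le_univ_sum_of_nonneg fun _ => Nat.zero_le _
    _ = 2 * #G.edgeFinset := G.sum_degrees_eq_twice_card_edges
    _ ≤ 2 * (2 * k * #S) := Nat.mul_le_mul_left 2 (h.card_edgeFinset_le hS)
    _ = 4 * k * #S := by ring

theorem exists_adj_degree_le [Fintype V] [DecidableRel G.Adj] (h : IsStackOrder G k)
    (hG : G ≠ ⊥) (hdeg : ∀ x ∈ G.support, k < G.degree x) :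
    ∃ x y, G.Adj x y ∧ G.degree x ≤ 4 * k * (4 * k + 1) ∧ G.degree y ≤ 4 * k * (4 * k + 1) := by
  classical
  set l := 4 * k * (4 * k + 1) with hl
  by_contra! hlight
  let small : Finset V := {x | x ∈ G.support ∧ G.degree x ≤ l}
  let big : Finset V := {x | l < G.degree x}
  have hdisj : Disjoint small big := disjoint_filter.mpr fun x _ hx => not_lt.mpr hx.2
  have hsmall : #small ≤ 4 * k * #big := by
    refine h.card_le_of_lt_degree hdisj (fun a ha b hab => ?_) fun a ha =>
      hdeg a (mem_filter.mp ha).2.1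
    exact mem_filter.mpr ⟨mem_univ b, hlight a b hab (mem_filter.mp ha).2.2⟩
  have hsupport : G.support ⊆ (small ∪ big : Finset V) := fun a ha => by
    simpa [small, big, ha] using le_or_gt (G.degree a) l
  have hbig : #big * (l + 1) ≤ #big * l :=
    calc #big * (l + 1) ≤ ∑ x ∈ big, G.degree x := by
          rw [← smul_eq_mul]
          exact card_nsmul_le_sum big _ _ fun x hx => (mem_filter.mp hx).2
      _ ≤ 4 * k * #(small ∪ big) := h.sum_degree_le hsupport big
      _ ≤ 4 * k * (4 * k * #big + #big) := by
          gcongr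
          exact (card_union_le _ _).trans (Nat.add_le_add_right hsmall _)
      _ = #big * l := by rw [hl]; ring
  have hbig_empty : big = ∅ := by
    rw [mul_add_one] at hbig
    exact card_eq_zero.mp (by omega)
  have hsmall_empty : small = ∅ := by simpa [hbig_empty] using hsmall
  obtain ⟨a, b, hab⟩ := SimpleGraph.ne_bot_iff_exists_adj.mp hG
  simpa [hsmall_empty, hbig_empty] using hsupport ⟨b, hab⟩

theorem hasLowVertexOrLightEdge [Finite V] (h : IsStackOrder G k) (hG : G ≠ ⊥) :
    HasLowVertexOrLightEdge G k (4 * k * (4 * k + 1)) := by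
  classical
  have := Fintype.ofFinite V
  have encard_neighborSet (x : V) : (G.neighborSet x).encard = G.degree x := by
    rw [Set.encard_eq_coe_toFinset_card, ← G.card_neighborFinset_eq_degree]
    rfl
  simp only [HasLowVertexOrLightEdge, encard_neighborSet, Nat.cast_le]
  refine or_iff_not_imp_left.mpr fun hlow => h.exists_adj_degree_le hG fun x hx => ?_
  exact not_le.mp fun hle => hlow ⟨x, hx, hle⟩

theorem defectiveChoosable [Finite V] (h : IsStackOrder G k) :
    DefectiveChoosable G (k + 1) (4 * k * (4 * k + 1)) :=
  defectiveChoosable_of_forall_le_hasLowVertexOrLightEdge fun _ hle hne =>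
    (h.mono hle).hasLowVertexOrLightEdge hne

theorem mem_stackGraphs [Finite V] (h : IsStackOrder G k) : stackGraphs k V G := by
  have := Fintype.ofFinite V
  obtain ⟨H, hH, hG⟩ := h
  have hpage : ∀ e : G.edgeSet, ∃ p, e.1 ∈ (H p).edgeSet := by
    rintro ⟨e, he⟩
    induction e with
    | _ a b => simpa [hG] using he
  choose page hpage using hpage
  let e : Fin (Fintype.card V) ≃o V := Fintype.orderIsoFinOfCardEq V rfl
  refine ⟨⟨_, e.toEquiv, page, fun a b c d hab hcd hac hcb hbd heq => ?_⟩⟩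
  have hab_page := hpage ⟨s(e a, e b), hab⟩
  have hcd_page := hpage ⟨s(e c, e d), hcd⟩
  exact hH _ (e.lt_iff_lt.mpr hac) (e.lt_iff_lt.mpr hcb) (e.lt_iff_lt.mpr hbd) hab_page
    (heq ▸ hcd_page)

end IsStackOrder

theorem StackLayout.exists_isStackOrder {V : Type u} {G : SimpleGraph V} {k : ℕ}
    (L : StackLayout G k) : ∃ _ : LinearOrder V, IsStackOrder G k := by
  let order : LinearOrder V := LinearOrder.lift' L.v.symm L.v.symm.injective
  let H (p : Fin k) : SimpleGraph V :=
    SimpleGraph.fromEdgeSet {e | ∃ he : e ∈ G.edgeSet, L.page ⟨e, he⟩ = p}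
  have adj_H {p a b} : (H p).Adj a b ↔ ∃ hab : G.Adj a b, L.page ⟨s(a, b), hab⟩ = p := by
    simpa [H] using fun hab _ => hab.ne
  refine ⟨order, H, fun p a b c d hab hbc hcd hac hbd => ?_, ?_⟩
  · obtain ⟨hac, hpac⟩ := adj_H.mp hac
    obtain ⟨hbd, hpbd⟩ := adj_H.mp hbd
    have := L.noncrossing (L.v.symm a) (L.v.symm c) (L.v.symm b) (L.v.symm d)
      (by simpa using hac) (by simpa using hbd) hab hbc hcd
    simp only [Equiv.apply_symm_apply] at this
    exact this (hpac.trans hpbd.symm)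
  · ext a b
    simp [adj_H]

theorem StackLayout.defectiveChoosable {V : Type u} {G : SimpleGraph V} {k : ℕ}
    (L : StackLayout G k) : DefectiveChoosable G (k + 1) (4 * k * (4 * k + 1)) := by
  obtain ⟨_, h⟩ := L.exists_isStackOrder
  have : Finite V := Finite.of_equiv _ L.v
  exact h.defectiveChoosable

section LowerBound

variable {V : Type u} {G : SimpleGraph V} {k d : ℕ}

theorem HasDefect.comp_copy {W : Type*} {G' : SimpleGraph W} {α : Type*} {c : W → α}
    (hc : HasDefect G' c d) (f : SimpleGraph.Copy G G') : HasDefect G (c ∘ f) d := by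
  intro x
  rw [← f.injective.encard_image]
  refine (Set.encard_le_encard ?_).trans (hc (f x))
  rintro _ ⟨y, ⟨hxy, hy⟩, rfl⟩
  exact ⟨f.toHom.map_adj hxy, hy⟩

theorem hasDefect_comp_iff_of_injective {α β : Type*} {c : V → α} {g : α → β}
    (hg : Function.Injective g) : HasDefect G (g ∘ c) d ↔ HasDefect G c d := by
  simp only [HasDefect, Function.comp_apply, hg.eq_iff]

theorem HasDefect.defectiveColorable_of_forall_ne {c : V → Fin (k + 1)} (hc : HasDefect G c d)
    {t : Fin (k + 1)} (ht : ∀ x, c x ≠ t) : DefectiveColorable G k d := by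
  choose c' hc' using fun x => Fin.exists_succAbove_eq (ht x)
  refine ⟨c', (hasDefect_comp_iff_of_injective (Fin.succAbove_right_injective (p := t))).mp ?_⟩
  rwa [show t.succAbove ∘ c' = c from funext hc']

theorem DefectiveColorable.mono {j : ℕ} (h : DefectiveColorable G j d) (hjk : j ≤ k) :
    DefectiveColorable G k d := by
  obtain ⟨c, hc⟩ := h
  exact ⟨Fin.castLE hjk ∘ c, (hasDefect_comp_iff_of_injective (Fin.castLE_injective hjk)).mpr hc⟩

theorem DefectiveChoosable.defectiveColorable (h : DefectiveChoosable G k d) :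
    DefectiveColorable G k d := by
  obtain ⟨c, -, hc⟩ := h (Fin k) (fun _ => Finset.univ) (fun _ => Finset.card_fin k)
  exact ⟨c, hc⟩

theorem not_defectiveColorable_succ_of_disjoint_copies {W : Type u} {G' : SimpleGraph W}
    (hG : ¬ DefectiveColorable G k d) (r : W) (f : Fin (d + 1) → SimpleGraph.Copy G G')
    (hf : ∀ i j x y, f i x = f j y → i = j) (hr : ∀ i x, G'.Adj r (f i x)) :
    ¬ DefectiveColorable G' (k + 1) d := by
  rintro ⟨c, hc⟩
  have hmeets : ∀ i, ∃ x, c (f i x) = c r := by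
    by_contra! ⟨i, hi⟩
    exact hG ((hc.comp_copy (f i)).defectiveColorable_of_forall_ne hi)
  choose x hx using hmeets
  have hinj : Function.Injective fun i => f i (x i) := fun i j hij => hf i j _ _ hij
  have hcard : ((d + 1 : ℕ) : ℕ∞) ≤ d :=
    calc ((d + 1 : ℕ) : ℕ∞) = (Set.range fun i => f i (x i)).encard := by
          rw [← Set.image_univ, hinj.encard_image]; simp
      _ ≤ {y | G'.Adj r y ∧ c y = c r}.encard :=
          Set.encard_le_encard (Set.range_subset_iff.mpr fun i => ⟨hr i (x i), hx i⟩)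
      _ ≤ d := hc r
  exact absurd (Nat.cast_le.mp hcard) d.lt_succ_self.not_ge

/-- The disjoint union of copies of `G` indexed by `ι`, placed one after another in the
lexicographic order. -/
def copies (ι : Type*) (G : SimpleGraph V) : SimpleGraph (ι ×ₗ V) :=
  ((⊥ : SimpleGraph ι) □ G).comap ofLex

theorem copies_adj {ι : Type*} {a b : ι ×ₗ V} :
    (copies ι G).Adj a b ↔ (ofLex a).1 = (ofLex b).1 ∧ G.Adj (ofLex a).2 (ofLex b).2 := by
  simp [copies, SimpleGraph.boxProd_adj, and_comm]

/-- The graph obtained from `G` by adding a vertex adjacent to all others and placing it first. -/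
def cone (G : SimpleGraph V) : SimpleGraph (WithBot V) :=
  SimpleGraph.starGraph ⊥ ⊔ G.map Function.Embedding.coeWithBot

theorem IsNoncrossing.copies [LinearOrder V] {H : SimpleGraph V} (h : IsNoncrossing H)
    (ι : Type*) [LinearOrder ι] : IsNoncrossing (copies ι H) := by
  intro a b c d hab hbc hcd hac hbd
  obtain ⟨hac_fst, hac⟩ := copies_adj.mp hac
  obtain ⟨hbd_fst, hbd⟩ := copies_adj.mp hbd
  rw [Prod.Lex.lt_iff'] at hab hbc hcd
  have hab_fst := le_antisymm hab.1 (hac_fst ▸ hbc.1)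
  have hbc_fst := hab_fst.symm.trans hac_fst
  exact h (hab.2 hab_fst) (hbc.2 hbc_fst) (hcd.2 (hbc_fst.symm.trans hbd_fst)) hac hbd

theorem IsStackOrder.copies [LinearOrder V] (h : IsStackOrder G k) (ι : Type*) [LinearOrder ι] :
    IsStackOrder (copies ι G) k := by
  obtain ⟨H, hH, rfl⟩ := h
  refine ⟨fun p => _root_.copies ι (H p), fun p => (hH p).copies ι, ?_⟩
  ext a b
  simp [copies_adj]

theorem IsStackOrder.cone [LinearOrder V] (h : IsStackOrder G k) :
    IsStackOrder (cone G) (k + 1) := by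
  obtain ⟨H, hH, rfl⟩ := h
  refine ⟨Fin.cons (SimpleGraph.starGraph ⊥) fun p => (H p).map Function.Embedding.coeWithBot,
    Fin.cases (.starGraph ⊥) fun p => (hH p).map WithBot.coeOrderHom, ?_⟩
  ext a b
  simp only [_root_.cone, SimpleGraph.sup_adj, SimpleGraph.map_adj, SimpleGraph.iSup_adj,
    Fin.exists_fin_succ, Fin.cons_zero, Fin.cons_succ]
  aesop

theorem not_defectiveColorable_cone_copies (hG : ¬ DefectiveColorable G k d) :
    ¬ DefectiveColorable (cone (copies (Fin (d + 1)) G)) (k + 1) d := by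
  let f (i : Fin (d + 1)) : G →g cone (copies (Fin (d + 1)) G) :=
    { toFun := fun x => (toLex (i, x) : Fin (d + 1) ×ₗ V)
      map_rel' := fun hxy => .inr (SimpleGraph.map_adj_apply.mpr (copies_adj.mpr ⟨rfl, hxy⟩)) }
  have hf : ∀ {i j x y}, f i x = f j y → i = j ∧ x = y := fun h =>
    Prod.ext_iff.mp (toLex.injective (WithBot.coe_injective h))
  exact not_defectiveColorable_succ_of_disjoint_copies hG ⊥
    (fun i => (f i).toCopy fun _ _ hxy => (hf hxy).2) (fun _ _ _ _ hxy => (hf hxy).1)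
    fun _ _ => .inl (SimpleGraph.starGraph_center_adj (WithBot.bot_ne_coe))

theorem exists_isStackOrder_not_defectiveColorable (k d : ℕ) :
    ∃ (V : Type u) (_ : LinearOrder V) (_ : Finite V) (G : SimpleGraph V),
      IsStackOrder G k ∧ ¬ DefectiveColorable G k d := by
  induction k with
  | zero =>
    refine ⟨PUnit, inferInstance, inferInstance, ⊥, ⟨fun _ => ⊥, finZeroElim, by simp⟩, ?_⟩
    rintro ⟨c, -⟩
    exact (c PUnit.unit).elim0
  | succ k ih =>
    obtain ⟨V, _, _, G, hG, hcol⟩ := ih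
    exact ⟨WithBot (Fin (d + 1) ×ₗ V), inferInstance,
      inferInstanceAs (Finite (Option (Fin (d + 1) × V))), cone (copies (Fin (d + 1)) G),
      (hG.copies _).cone, not_defectiveColorable_cone_copies hcol⟩

theorem lt_of_forall_stackGraphs_defectiveColorable {j : ℕ}
    (h : ∀ (V : Type u) (G : SimpleGraph V), stackGraphs k V G → DefectiveColorable G j d) :
    k < j := by
  by_contra! hjk
  obtain ⟨V, _, _, G, hG, hcol⟩ := exists_isStackOrder_not_defectiveColorable.{u} k d
  exact hcol ((h V G hG.mem_stackGraphs).mono hjk)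

end LowerBound

theorem pow_le_two_rpow_mul_log {x : ℝ} (hx : 2 ≤ x) (n : ℕ) :
    x ^ n ≤ (2 : ℝ) ^ (n * (x * Real.log x)) := by
  have hlog : 0 ≤ Real.log x := Real.log_nonneg (by linarith)
  have hx_log : 1 ≤ x * Real.log 2 := by nlinarith [Real.log_two_gt_d9]
  rw [← Real.rpow_natCast, Real.rpow_def_of_pos (by linarith), Real.rpow_def_of_pos two_pos,
    Real.exp_le_exp]
  calc Real.log x * n ≤ Real.log x * n * (x * Real.log 2) :=
        le_mul_of_one_le_right (by positivity) hx_log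
    _ = Real.log 2 * (n * (x * Real.log x)) := by ring

theorem four_mul_mul_le_two_rpow_mul_log {x : ℝ} (hx : 2 ≤ x) :
    4 * x * (4 * x + 1) ≤ (2 : ℝ) ^ (7 * (x * Real.log x)) := by
  have hsq : 4 ≤ x ^ 2 := by nlinarith
  have hlinear : 4 * x + 1 ≤ x ^ 4 := by nlinarith
  calc 4 * x * (4 * x + 1) ≤ x ^ 2 * x * x ^ 4 := by gcongr
    _ = x ^ 7 := by ring
    _ ≤ (2 : ℝ) ^ (7 * (x * Real.log x)) := by exact_mod_cast pow_le_two_rpow_mul_log hx 7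

theorem mainTheorem6_general :
    (∀ k : ℕ, IsDefectiveChromaticNumber (stackGraphs.{u} k) (k + 1) ∧
      IsDefectiveChoiceNumber (stackGraphs.{u} k) (k + 1)) ∧
    ∀ (k : ℕ) (V : Type u) (G : SimpleGraph V), stackGraphs.{u} k V G →
      DefectiveChoosable G (k + 1) (4 * k * (4 * k + 1)) := by
  have upper : ∀ (k : ℕ) (V : Type u) (G : SimpleGraph V), stackGraphs.{u} k V G →
      DefectiveChoosable G (k + 1) (4 * k * (4 * k + 1)) := fun k V G ⟨L⟩ => L.defectiveChoosable
  refine ⟨fun k => ⟨⟨⟨_, fun V G hG => (upper k V G hG).defectiveColorable⟩, ?_⟩,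
    ⟨⟨_, upper k⟩, ?_⟩⟩, upper⟩
  · rintro j ⟨d, hd⟩
    exact lt_of_forall_stackGraphs_defectiveColorable hd
  · rintro j ⟨d, hd⟩
    exact lt_of_forall_stackGraphs_defectiveColorable fun V G hG => (hd V G hG).defectiveColorable

theorem mainTheorem6 :
    (∀ k : ℕ, IsDefectiveChromaticNumber (stackGraphs.{u} k) (k + 1) ∧
      IsDefectiveChoiceNumber (stackGraphs.{u} k) (k + 1)) ∧
    ∃ d : ℕ → ℕ,
      (∃ C : ℝ, ∀ k : ℕ, 2 ≤ k → (d k : ℝ) ≤ (2 : ℝ) ^ (C * ((k : ℝ) * Real.log (k : ℝ)))) ∧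
      ∀ (k : ℕ) (V : Type u) (G : SimpleGraph V), stackGraphs.{u} k V G →
        DefectiveChoosable G (k + 1) (d k) := by
  exact ⟨mainTheorem6_general.1, fun k => 4 * k * (4 * k + 1), ⟨7, fun k hk => by
    exact_mod_cast four_mul_mul_le_two_rpow_mul_log (Nat.ofNat_le_cast.mpr hk)⟩,
    mainTheorem6_general.2⟩
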